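/- \textbf{Setting.} Fix $k\in\mathbb N$, $x\in[0,1]$, $\varepsilon\ge 0$, and let $x_\varepsilon=\{y\in\mathbb R: |y-x|<\varepsilon\}$ if $\varepsilon>0$ and $x_\varepsilon=\{x\}$ if $\varepsilon=0$. An \emph{instance} is a vector $p=(p_1,\dots,p_k)\in[0,1]^k$ of Bernoulli means. It is \emph{$(x,\varepsilon)$-feasible} if some convex combination of $p_1,\dots,p_k$ lies in $x_\varepsilon$, and \emph{$(x,\varepsilon)$-infeasible} if the means are separated from $x_\varepsilon$: there is $a\in\mathbb R$ with $(p_i-y)a<0$ for all $i$ and all $y\in x_\varepsilon$. The \emph{boundary} is the topological boundary, in $[0,1]^k$, of the set of feasible instances. A \emph{deterministic policy} maps the history of all actions chosen and samples seen so far either to the action $i\in\{1,\dots,k\}$ to sample next or to termination with the output ``feasible'' or ``infeasible''. Under the instance $p$ each sample of action $i$ is a Bernoulli$(p_i)$ variable, independent of the past. Let $\tau\in\{0,1,2,\dots\}\cup\{\infty\}$ be the number of samples drawn before termination. For $\delta\in(0,\tfrac12)$ the policy is \emph{$(1-\delta)$-sound} if (i) for every instance $p$ not on the boundary, $E_p[\tau]<\infty$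 and, with $P_p$-probability at least $1-\delta$, the policy terminates with the correct output; (ii) for every instance $p$ on the boundary, the policy terminates with the wrong output with $P_p$-probability at most $\delta$ (it may fail to terminate). For $u\in[0,1]$ and $v\in\mathbb R$ let $D(u|v)\in[0,\infty]$ be the Kullback--Leibler divergence of Bernoulli$(u)$ with respect to Bernoulli$(v)$ if $v\in[0,1]$, and $D(u|v)=\infty$ if $v\notin[0,1]$; put $0^{-1}=\infty$ and $\infty^{-1}=0$. \textbf{Theorem.} Let $0<\delta<\tfrac12$. For every deterministic $(1-\delta)$-sound policy and every $(x,\varepsilon)$-infeasible instance $p$, $$E_p[\tau]\;\ge\;\sum_{i=1}^k \max\left\{D(p_i|x-\varepsilon)^{-1},\,D(p_i|x+\varepsilon)^{-1}\right\}\cdot\frac12\log\frac1{4\delta}.$$ (For $\delta\ge\tfrac14$ the logarithm is nonpositive, and the claim is just $E_p[\tau]\ge 0$.) -/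

import Mathlib

open MeasureTheory ProbabilityTheory
open scoped ENNReal unitInterval

namespace HullFeasibility

/-- The set `x_ε`: the open interval of radius `ε` around `x`, and the single point `x` if `ε = 0`. -/
def target (x ε : ℝ) : Set ℝ :=
  {y | if ε = 0 then y = x else |y - x| < ε}

/-- A problem instance is a vector of `k` Bernoulli means. It is `(x, ε)`-feasible if some
convex combination of the means is a point of `x_ε`. -/
def Feasible {k : ℕ} (x ε : ℝ) (p : Fin k → I) : Prop :=
  ∃ y ∈ target x ε, ∃ w ∈ stdSimplex ℝ (Fin k), y = ∑ i, w i * (p i : ℝ)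

/-- A problem instance is `(x, ε)`-infeasible if the means are separated from `x_ε`. -/
def Infeasible {k : ℕ} (x ε : ℝ) (p : Fin k → I) : Prop :=
  ∃ a : ℝ, ∀ i : Fin k, ∀ y ∈ target x ε, ((p i : ℝ) - y) * a < 0

/-- The instances on the boundary between the two cases: the topological boundary, in `[0,1]^k`,
of the set of feasible instances. -/
def boundary (k : ℕ) (x ε : ℝ) : Set (Fin k → I) :=
  frontier {p | Feasible x ε p}

/-- The possible outputs of a policy. -/
inductive Answer
  | feasible
  | infeasible

/-- What a policy does after a history: sample one more time, from action `i`, or terminate. -/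
inductive Decision (k : ℕ)
  | sample (i : Fin k)
  | terminate (a : Answer)

/-- A deterministic policy: a map from histories (the list of the pairs of an action and the
sample drawn from it, most recent first) to decisions. -/
abbrev Policy (k : ℕ) : Type := List (Fin k × Bool) → Decision k

/-- Sample paths: `ω t i` is the sample that is seen if action `i` is chosen at time `t`. -/
abbrev SamplePath (k : ℕ) : Type := ℕ → Fin k → Bool

/-- The law of the sample paths under the instance `p`: all `ω t i` are independent, and `ω t i`
is Bernoulli with mean `p i`. -/
noncomputable def law {k : ℕ} (p : Fin k → I) : Measure (SamplePath k) :=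
  Measure.infinitePi fun _ : ℕ => Measure.pi fun i : Fin k => bernoulliMeasure true false (p i)

/-- The history of the policy `π` at time `t`. After termination it does not change any more. -/
def history {k : ℕ} (π : Policy k) (ω : SamplePath k) : ℕ → List (Fin k × Bool)
  | 0 => []
  | t + 1 =>
    match π (history π ω t) with
    | .sample i => (i, ω t i) :: history π ω t
    | .terminate _ => history π ω t

/-- The policy terminates on the path `ω` with output `a`. -/
def Outputs {k : ℕ} (π : Policy k) (a : Answer) (ω : SamplePath k) : Prop :=
  ∃ t, π (history π ω t) = .terminate a

/-- The stopping time: the number of samples drawn before termination, and `∞` if the policy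
never terminates. -/
noncomputable def stoppingTime {k : ℕ} (π : Policy k) (ω : SamplePath k) : ℝ≥0∞ :=
  ⨅ (t : ℕ) (_ : ∃ a, π (history π ω t) = .terminate a), (t : ℝ≥0∞)

/-- The expected stopping time under the instance `p`. -/
noncomputable def expectedStoppingTime {k : ℕ} (π : Policy k) (p : Fin k → I) : ℝ≥0∞ :=
  ∫⁻ ω, stoppingTime π ω ∂(law p)

/-- The policy is `(1 - δ)`-sound for `(x, ε)`. Off the boundary between the two cases, its
expected stopping time is finite and it outputs the right answer with probability at least `1 - δ`.
On the boundary no policy with `δ < 1 / 2` can do that, because instances of the other case are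
arbitrarily close; there we only ask for the weaker property that the policy terminates with the
wrong answer with probability at most `δ`, and it may fail to terminate. -/
structure IsSound {k : ℕ} (π : Policy k) (x ε δ : ℝ) : Prop where
  finite : ∀ p : Fin k → I, p ∉ boundary k x ε → expectedStoppingTime π p < ∞
  feasible : ∀ p : Fin k → I, p ∉ boundary k x ε → Feasible x ε p →
    1 - δ ≤ (law p).real {ω | Outputs π .feasible ω}
  infeasible : ∀ p : Fin k → I, p ∉ boundary k x ε → Infeasible x ε p →
    1 - δ ≤ (law p).real {ω | Outputs π .infeasible ω}
  boundary_feasible : ∀ p : Fin k → I, p ∈ boundary k x ε → Feasible x ε p →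
    (law p).real {ω | Outputs π .infeasible ω} ≤ δ
  boundary_infeasible : ∀ p : Fin k → I, p ∈ boundary k x ε → Infeasible x ε p →
    (law p).real {ω | Outputs π .feasible ω} ≤ δ

open Classical in
/-- The Kullback-Leibler divergence `D(p|q)` of the Bernoulli law of mean `p` from that of mean `q`.
It is `∞` if `q` is not in `[0,1]`, where there is no Bernoulli law of mean `q`. -/
noncomputable def bernoulliKL (p : I) (q : ℝ) : ℝ≥0∞ :=
  if hq : q ∈ Set.Icc (0 : ℝ) 1 then
    InformationTheory.klDiv (bernoulliMeasure true false p) (bernoulliMeasure true false ⟨q, hq⟩)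
  else ∞

end HullFeasibility

namespace HullFeasibility

open Filter Topology

variable {k : ℕ}

/-! Each action needs its own lower bound. Replacing the single mean `p i` by a point `q` of the
target set makes the instance feasible, since `q` alone is a convex combination of the means. So
"infeasible" is output with probability at most `δ` after the change, but at least `1 - δ` before
it. Telling the two instances apart costs information, and only samples of action `i` carry any: the
expected log-likelihood ratio is the divergence times the expected count of action `i`
(`integral_neg_log_historyWeight`). A Donsker–Varadhan type inequality
(`log_mul_measureReal_sub_log_two_le`) turns this into `D * E[N_i] ≥ log (1/δ) * P(infeasible) - log
2`.

Let `q` tend to an endpoint `x ± ε`, which need not be in the target set, and let time tend to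
infinity. Since `1 - δ ≥ 1/2`, the right side is then at least `1/2 * log (1/(4δ))`. The counts of
all actions add up to at most the stopping time, so the bounds may be summed.

Everything is computed at a fixed time from the frozen history, which takes finitely many values, so
no optional stopping theorem is needed. -/

instance (p : Fin k → I) : IsProbabilityMeasure (law p) := by
  unfold law; infer_instance

/-! ### Histories and their one-step expectations -/

lemma history_congr (π : Policy k) {ω ω' : SamplePath k} :
    ∀ n, (∀ t < n, ω t = ω' t) → history π ω n = history π ω' n
  | 0, _ => rfl
  | n + 1, h => by
    have ih := history_congr π n fun t ht => h t (ht.trans n.lt_succ_self)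
    simp only [history, ih, h n n.lt_succ_self]

lemma length_history_le (π : Policy k) (ω : SamplePath k) : ∀ n, (history π ω n).length ≤ n
  | 0 => le_rfl
  | n + 1 => by
    have ih := length_history_le π ω n
    rw [history]
    split
    · simpa using ih
    · exact ih.trans n.le_succ

/-- The history at time `n`, as a function of the samples at the times before `n`. -/
def historyOfPrefix (π : Policy k) (n : ℕ) (v : Finset.range n → Fin k → Bool) :
    List (Fin k × Bool) :=
  history π (fun t => if h : t ∈ Finset.range n then v ⟨t, h⟩ else fun _ => false) n

lemma historyOfPrefix_restrict (π : Policy k) (n : ℕ) (ω : SamplePath k) :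
    historyOfPrefix π n (fun t => ω t) = history π ω n :=
  history_congr π n fun t ht => by simp [Finset.mem_range.2 ht]

/-- Only finitely many binary samples precede time `n`, so any `F` is allowed and lists need no
σ-algebra. -/
lemma measurable_comp_history {α : Type*} [MeasurableSpace α] (π : Policy k) (n : ℕ)
    (F : List (Fin k × Bool) → α) : Measurable fun ω => F (history π ω n) := by
  have h : Measurable fun v : Finset.range n → Fin k → Bool => F (historyOfPrefix π n v) :=
    measurable_of_finite _
  have h2 : Measurable fun (ω : SamplePath k) (t : Finset.range n) => ω t := by fun_prop
  simpa only [Function.comp_def, historyOfPrefix_restrict] using h.comp h2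

lemma integrable_comp_history (π : Policy k) (n : ℕ) (F : List (Fin k × Bool) → ℝ)
    (μ : Measure (SamplePath k)) [IsFiniteMeasure μ] :
    Integrable (fun ω => F (history π ω n)) μ := by
  obtain ⟨C, hC⟩ := (Set.finite_range fun v => ‖F (historyOfPrefix π n v)‖).bddAbove
  refine Integrable.of_bound (measurable_comp_history π n F).aestronglyMeasurable C
    (.of_forall fun ω => ?_)
  rw [← historyOfPrefix_restrict]
  exact hC ⟨_, rfl⟩

/-- The history at time `n` is independent of the samples at time `n`. -/
lemma indepFun_history [MeasurableSpace (List (Fin k × Bool))] (π : Policy k) (n : ℕ)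
    (p : Fin k → I) :
    IndepFun (fun ω => history π ω n) (fun ω : SamplePath k => ω n) (law p) := by
  have h : iIndepFun (fun (t : ℕ) (ω : SamplePath k) => ω t) (law p) :=
    iIndepFun_infinitePi (X := fun _ y => y) (by fun_prop)
  have h2 := h.indepFun_finset (Finset.range n) {n} (by simp) (by fun_prop)
  have hψ : Measurable fun v : ({n} : Finset ℕ) → Fin k → Bool =>
      v ⟨n, Finset.mem_singleton_self n⟩ := measurable_pi_apply _
  have h3 := h2.comp (φ := historyOfPrefix π n) (measurable_of_finite _) hψ
  simpa only [Function.comp_def, historyOfPrefix_restrict] using h3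

/-- The conditional mean, given the history `h`, of a function of the history one step later. -/
def stepMean (π : Policy k) (p : Fin k → I) (F : List (Fin k × Bool) → ℝ)
    (h : List (Fin k × Bool)) : ℝ :=
  match π h with
  | .sample j => p j * F ((j, true) :: h) + (1 - p j) * F ((j, false) :: h)
  | .terminate _ => F h

lemma integral_history_succ (π : Policy k) (p : Fin k → I) (n : ℕ)
    (F : List (Fin k × Bool) → ℝ) :
    ∫ ω, F (history π ω (n + 1)) ∂law p = ∫ ω, stepMean π p F (history π ω n) ∂law p := by
  let : MeasurableSpace (List (Fin k × Bool)) := ⊤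
  have : DiscreteMeasurableSpace (List (Fin k × Bool)) := ⟨fun _ => trivial⟩
  -- Past and fresh samples become separate variables, so that independence and Fubini apply.
  let G : List (Fin k × Bool) × (Fin k → Bool) → ℝ := fun z =>
    match π z.1 with
    | .sample j => F ((j, z.2 j) :: z.1)
    | .terminate _ => F z.1
  have hG : Measurable G := measurable_from_prod_countable_right fun _ => measurable_of_finite _
  have hFG : ∀ ω : SamplePath k, F (history π ω (n + 1)) = G (history π ω n, ω n) := by
    intro ω
    simp only [history, G]
    split <;> simp_all
  have hH : Measurable fun ω : SamplePath k => history π ω n := measurable_comp_history π n id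
  have hpair : Measurable fun ω : SamplePath k => (history π ω n, ω n) := by fun_prop
  have hmap : (law p).map (fun ω => (history π ω n, ω n)) =
      ((law p).map fun ω => history π ω n).prod
        (Measure.pi fun i => bernoulliMeasure true false (p i)) := by
    rw [(indepFun_history π n p).map_prod_eq_prod_map_map hH.aemeasurable
      (measurable_pi_apply n).aemeasurable]
    congr 1
    exact Measure.infinitePi_map_eval _ n
  have : IsProbabilityMeasure ((law p).map fun ω => history π ω n) :=
    Measure.isProbabilityMeasure_map hH.aemeasurable
  have hint : Integrable G (((law p).map fun ω => history π ω n).prod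
        (Measure.pi fun i => bernoulliMeasure true false (p i))) := by
    rw [← hmap, integrable_map_measure hG.aestronglyMeasurable hpair.aemeasurable]
    simpa only [Function.comp_def, ← hFG] using integrable_comp_history π (n + 1) F (law p)
  simp_rw [hFG]
  rw [← integral_map (φ := fun ω => (history π ω n, ω n)) hpair.aemeasurable
    hG.aestronglyMeasurable, hmap, integral_prod _ hint,
    integral_map hH.aemeasurable (Measurable.of_discrete).aestronglyMeasurable]
  refine integral_congr_ae (.of_forall fun ω => ?_)
  simp only [G, stepMean]
  split
  · rename_i j _
    rw [integral_comp_eval (μ := fun i => bernoulliMeasure true false (p i)) (i := j)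
      (f := fun b => F ((j, b) :: history π ω n)) (measurable_of_finite _).aestronglyMeasurable,
      integral_bernoulliMeasure]
    simp
  · simp

lemma integral_history_zero (π : Policy k) (p : Fin k → I) (F : List (Fin k × Bool) → ℝ) :
    ∫ ω, F (history π ω 0) ∂law p = F [] := by
  simp [history]

/-- Functions of the history that are harmonic for the policy have constant mean. -/
lemma integral_history_of_stepMean_eq (π : Policy k) (p : Fin k → I)
    {F : List (Fin k × Bool) → ℝ} (hF : stepMean π p F = F) (n : ℕ) :
    ∫ ω, F (history π ω n) ∂law p = F [] := by
  induction n with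
  | zero => exact integral_history_zero π p F
  | succ n ih => rw [integral_history_succ, hF, ih]

lemma stepMean_nonneg (π : Policy k) (p : Fin k → I) {F : List (Fin k × Bool) → ℝ}
    (hF : ∀ h, 0 ≤ F h) (h : List (Fin k × Bool)) : 0 ≤ stepMean π p F h := by
  rw [stepMean]
  split
  · exact add_nonneg (mul_nonneg (p _).2.1 (hF _))
      (mul_nonneg (sub_nonneg.2 (p _).2.2) (hF _))
  · exact hF h

/-- If a weight `W` grows at each step by at most the likelihood ratio of `p'` to `p`, then
`W`-weighted means under `p` are at most the means under `p'`. -/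
lemma integral_weight_mul_le (π : Policy k) (p p' : Fin k → I) {W : List (Fin k × Bool) → ℝ}
    (hW1 : W [] = 1)
    (htrue : ∀ j h, p j * W ((j, true) :: h) ≤ W h * p' j)
    (hfalse : ∀ j h, (1 - p j) * W ((j, false) :: h) ≤ W h * (1 - p' j)) (n : ℕ)
    {g : List (Fin k × Bool) → ℝ} (hg : ∀ h, 0 ≤ g h) :
    ∫ ω, W (history π ω n) * g (history π ω n) ∂law p ≤ ∫ ω, g (history π ω n) ∂law p' := by
  induction n generalizing g with
  | zero =>
    rw [integral_history_zero π p fun h => W h * g h, integral_history_zero]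
    simp [hW1]
  | succ n ih =>
    rw [integral_history_succ π p n fun h => W h * g h, integral_history_succ]
    -- The induction hypothesis is used for the one-step mean of `g` under `p'`, not for `g` itself.
    refine le_trans ?_ (ih (stepMean_nonneg π p' hg))
    refine integral_mono (integrable_comp_history π n _ _)
      (integrable_comp_history π n (fun h => W h * stepMean π p' g h) _) fun ω => ?_
    simp only [stepMean]
    split
    · rename_i j _
      have h1 := mul_le_mul_of_nonneg_right (htrue j (history π ω n))
        (hg ((j, true) :: history π ω n))
      have h2 := mul_le_mul_of_nonneg_right (hfalse j (history π ω n))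
        (hg ((j, false) :: history π ω n))
      linarith
    · rfl

/-! ### Likelihood ratios and change of measure -/

/-- The mass that the Bernoulli law of mean `u` gives to `b`. -/
def bernoulliMass (u : ℝ) (b : Bool) : ℝ := if b then u else 1 - u

open Classical in
/-- The likelihood ratio at `b` of the Bernoulli law of mean `v` to that of mean `u`, set to `1`
where the latter vanishes. -/
noncomputable def likelihoodRatio (u v : ℝ) (b : Bool) : ℝ :=
  if bernoulliMass u b = 0 then 1 else bernoulliMass v b / bernoulliMass u b

/-- The Kullback-Leibler divergence of Bernoulli laws, as a real number. -/
noncomputable def realKL (u v : ℝ) : ℝ :=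
  -(u * Real.log (likelihoodRatio u v true) + (1 - u) * Real.log (likelihoodRatio u v false))

lemma bernoulliMass_nonneg (u : I) (b : Bool) : 0 ≤ bernoulliMass u b := by
  cases b
  · simpa [bernoulliMass] using u.2.2
  · simpa [bernoulliMass] using u.2.1

lemma likelihoodRatio_pos {u v : I} {b : Bool}
    (h : bernoulliMass v b = 0 → bernoulliMass u b = 0) : 0 < likelihoodRatio u v b := by
  rw [likelihoodRatio]
  split_ifs with hu
  · exact one_pos
  · exact div_pos ((bernoulliMass_nonneg v b).lt_of_ne fun hv => hu (h hv.symm))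
      ((bernoulliMass_nonneg u b).lt_of_ne (Ne.symm hu))

/-- Equality fails only where `u` has no mass. The default ratio `1` keeps logarithms finite there,
and the inequality suffices for `integral_weight_mul_le`. -/
lemma bernoulliMass_mul_likelihoodRatio_le (u v : I) (b : Bool) :
    bernoulliMass u b * likelihoodRatio u v b ≤ bernoulliMass v b := by
  rw [likelihoodRatio]
  split_ifs with hu
  · simpa [hu] using bernoulliMass_nonneg v b
  · rw [mul_div_cancel₀ _ hu]

lemma continuous_likelihoodRatio (u : ℝ) (b : Bool) :
    Continuous fun v => likelihoodRatio u v b := by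
  cases b <;> simp only [likelihoodRatio, bernoulliMass] <;> split_ifs <;> fun_prop

lemma continuousAt_realKL {u v : I}
    (h : ∀ b, bernoulliMass v b = 0 → bernoulliMass u b = 0) : ContinuousAt (realKL u) v := by
  have hl : ∀ b, ContinuousAt (fun v => Real.log (likelihoodRatio u v b)) v := fun b =>
    (continuous_likelihoodRatio u b).continuousAt.log (likelihoodRatio_pos (h b)).ne'
  exact ((continuousAt_const.mul (hl true)).add (continuousAt_const.mul (hl false))).neg

/-- The likelihood ratio of a history when only the law of action `i` changes, with ratio `r`. -/
noncomputable def historyWeight (i : Fin k) (r : Bool → ℝ) : List (Fin k × Bool) → ℝ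
  | [] => 1
  | a :: h => historyWeight i r h * if a.1 = i then r a.2 else 1

lemma historyWeight_pos (i : Fin k) {r : Bool → ℝ} (hr : ∀ b, 0 < r b) :
    ∀ h, 0 < historyWeight i r h
  | [] => one_pos
  | a :: h => by
    rw [historyWeight]
    refine mul_pos (historyWeight_pos i hr h) ?_
    split_ifs
    exacts [hr _, one_pos]

/-- The number of times that action `i` was chosen in a history. -/
def actionCount (i : Fin k) (h : List (Fin k × Bool)) : ℕ := (h.map Prod.fst).count i

lemma actionCount_cons (i : Fin k) (a : Fin k × Bool) (h : List (Fin k × Bool)) :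
    actionCount i (a :: h) = actionCount i h + if a.1 = i then 1 else 0 := by
  simp [actionCount, List.count_cons]

/-- Wald's identity for the log-likelihood ratio of a stopped history. -/
lemma integral_neg_log_historyWeight (π : Policy k) (p : Fin k → I) (i : Fin k) {v : I}
    (hv : ∀ b, bernoulliMass v b = 0 → bernoulliMass (p i) b = 0) (n : ℕ) :
    ∫ ω, -Real.log (historyWeight i (likelihoodRatio (p i) v) (history π ω n)) ∂law p =
      realKL (p i) v * ∫ ω, (actionCount i (history π ω n) : ℝ) ∂law p := by
  have hr : ∀ b, 0 < likelihoodRatio (p i) v b := fun b => likelihoodRatio_pos (hv b)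
  -- The compensated log-likelihood is a martingale: a sample of action `i` raises the first term by
  -- `realKL (p i) v` on average, and other samples leave both terms unchanged.
  let F : List (Fin k × Bool) → ℝ := fun h =>
    -Real.log (historyWeight i (likelihoodRatio (p i) v) h) - realKL (p i) v * actionCount i h
  have hF : stepMean π p F = F := by
    funext h
    rw [stepMean]
    split
    · rename_i j _
      by_cases hj : j = i
      · subst hj
        simp only [F, historyWeight, actionCount_cons, if_true,
          Real.log_mul (historyWeight_pos j hr h).ne' (hr _).ne']
        push_cast
        simp only [realKL]
        ring
      · simp only [F, historyWeight, actionCount_cons, if_neg hj]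
        push_cast
        simp only [mul_one, add_zero]
        ring
    · rfl
  have h := integral_history_of_stepMean_eq π p hF n
  have h0 : F [] = 0 := by simp [F, historyWeight, actionCount]
  simp only [h0, F] at h
  rw [integral_sub (integrable_comp_history π n
      (fun h => -Real.log (historyWeight i (likelihoodRatio (p i) v) h)) _)
    (integrable_comp_history π n (fun h => realKL (p i) v * actionCount i h) _),
    integral_const_mul] at h
  linarith

/-- Transport of an event from one instance to another that differs in one action. -/
lemma log_mul_measureReal_sub_log_two_le (π : Policy k) (p : Fin k → I) (i : Fin k) {v : I}
    (hv : ∀ b, bernoulliMass v b = 0 → bernoulliMass (p i) b = 0) (n : ℕ) {δ : ℝ} (hδ : 0 < δ)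
    (hδ1 : δ ≤ 1) (A : Set (List (Fin k × Bool)))
    (hA : (law (Function.update p i v)).real {ω | history π ω n ∈ A} ≤ δ) :
    Real.log (1 / δ) * (law p).real {ω | history π ω n ∈ A} - Real.log 2 ≤
      realKL (p i) v * ∫ ω, (actionCount i (history π ω n) : ℝ) ∂law p := by
  classical
  have hr : ∀ b, 0 < likelihoodRatio (p i) v b := fun b => likelihoodRatio_pos (hv b)
  set W := historyWeight i (likelihoodRatio (p i) v) with hW
  have hmeas : MeasurableSet {ω : SamplePath k | history π ω n ∈ A} :=
    measurableSet_setOfPred.2 (measurable_comp_history π n (· ∈ A))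
  let e : List (Fin k × Bool) → ℝ := A.indicator 1
  have he : ∀ p : Fin k → I,
      ∫ ω, e (history π ω n) ∂law p = (law p).real {ω | history π ω n ∈ A} := by
    intro p
    rw [← integral_indicator_one hmeas]
    rfl
  -- The test function is `1/(2δ)` on `A` and `1/2` off it: large on `A`, yet of mean at most `1 -
  -- δ/2` under the changed instance.
  let g : List (Fin k × Bool) → ℝ := fun h => 1 / 2 + (1 / δ - 1) / 2 * e h
  have hδ2 : 0 ≤ 1 / δ - 1 := sub_nonneg.2 ((one_le_div hδ).2 hδ1)
  have he0 : ∀ h, 0 ≤ e h := fun h => Set.indicator_nonneg (fun _ _ => zero_le_one) h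
  have hg : ∀ h, 0 < g h := fun h => by
    have := mul_nonneg (div_nonneg hδ2 zero_le_two) (he0 h)
    simp only [g]
    linarith
  have hlog : ∀ h, Real.log (g h) = Real.log (1 / δ) * e h - Real.log 2 := by
    intro h
    by_cases hh : h ∈ A
    · have : g h = 1 / δ / 2 := by simp only [g, e, Set.indicator_of_mem hh, Pi.one_apply]; ring
      rw [this, Real.log_div (by positivity) two_ne_zero]
      simp [e, hh]
    · simp [g, e, hh]
  have hint := fun F : List (Fin k × Bool) → ℝ => integrable_comp_history π n F
  have hWg : ∫ ω, W (history π ω n) * g (history π ω n) ∂law p ≤ 1 := by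
    refine (integral_weight_mul_le π p (Function.update p i v) rfl ?_ ?_ n fun h => (hg h).le).trans
      ?_
    · intro j h
      rw [hW, historyWeight, mul_left_comm]
      refine mul_le_mul_of_nonneg_left ?_ (historyWeight_pos i hr h).le
      by_cases hj : j = i
      · subst hj
        simpa [bernoulliMass] using bernoulliMass_mul_likelihoodRatio_le (p j) v true
      · simp [hj]
    · intro j h
      rw [hW, historyWeight, mul_left_comm]
      refine mul_le_mul_of_nonneg_left ?_ (historyWeight_pos i hr h).le
      by_cases hj : j = i
      · subst hj
        simpa [bernoulliMass] using bernoulliMass_mul_likelihoodRatio_le (p j) v false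
      · simp [hj]
    · simp only [g]
      rw [integral_add (integrable_const _) ((hint e _).const_mul _), integral_const_mul, he]
      have : (1 / δ - 1) / 2 * δ = 1 / 2 - δ / 2 := by field_simp
      have h3 := mul_le_mul_of_nonneg_left hA (div_nonneg hδ2 zero_le_two)
      simp only [integral_const, probReal_univ, smul_eq_mul, one_mul]
      linarith
  rw [← integral_neg_log_historyWeight π p i hv n, ← hW]
  have hmono : ∫ ω, (1 - W (history π ω n) * g (history π ω n) +
      (Real.log (1 / δ) * e (history π ω n) - Real.log 2)) ∂law p ≤
      ∫ ω, -Real.log (W (history π ω n)) ∂law p := by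
    refine integral_mono (hint (fun h => 1 - W h * g h + (Real.log (1 / δ) * e h - Real.log 2)) _)
      (hint (fun h => -Real.log (W h)) _) fun ω => ?_
    have hWpos := historyWeight_pos i hr (history π ω n)
    -- Pointwise `log (W g) ≤ W g - 1`, whose right side has nonpositive mean by `hWg`.
    have h1 := Real.log_le_sub_one_of_pos (mul_pos hWpos (hg (history π ω n)))
    rw [Real.log_mul hWpos.ne' (hg _).ne', hlog] at h1
    simp only [← hW] at h1 ⊢
    linarith
  rw [integral_add (hint (fun h => 1 - W h * g h) _)
      (hint (fun h => Real.log (1 / δ) * e h - Real.log 2) _),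
    integral_sub (integrable_const _) (hint (fun h => W h * g h) _),
    integral_sub (hint (fun h => Real.log (1 / δ) * e h) _) (integrable_const _),
    integral_const_mul, he] at hmono
  simp only [integral_const, probReal_univ, smul_eq_mul, one_mul] at hmono
  linarith

/-! ### Agreement of `realKL` with the measure-theoretic divergence -/

lemma bernoulliMeasure_singleton (u : I) (b : Bool) :
    bernoulliMeasure true false u {b} = ENNReal.ofReal (bernoulliMass u b) := by
  rw [← ofReal_measureReal]
  cases b <;> simp [bernoulliMass]

lemma bernoulliMass_eq_zero_of_klDiv_ne_top {u v : I}
    (h : InformationTheory.klDiv (bernoulliMeasure true false u) (bernoulliMeasure true false v) ≠ ∞)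
    (b : Bool) (hb : bernoulliMass v b = 0) : bernoulliMass u b = 0 := by
  have h0 : bernoulliMeasure true false v {b} = 0 := by
    rw [bernoulliMeasure_singleton, hb, ENNReal.ofReal_zero]
  have h1 := (InformationTheory.klDiv_ne_top_iff.1 h).1 h0
  rw [bernoulliMeasure_singleton, ENNReal.ofReal_eq_zero] at h1
  exact le_antisymm h1 (bernoulliMass_nonneg u b)

lemma realKL_eq_toReal_klDiv {u v : I}
    (h : InformationTheory.klDiv (bernoulliMeasure true false u)
      (bernoulliMeasure true false v) ≠ ∞) :
    realKL u v = (InformationTheory.klDiv (bernoulliMeasure true false u)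
      (bernoulliMeasure true false v)).toReal := by
  have hac := (InformationTheory.klDiv_ne_top_iff.1 h).1
  have key : ∀ b, bernoulliMass u b *
      llr (bernoulliMeasure true false u) (bernoulliMeasure true false v) b =
      -(bernoulliMass u b * Real.log (likelihoodRatio u v b)) := by
    intro b
    by_cases hu : bernoulliMass u b = 0
    · simp [hu]
    · have hv : bernoulliMass v b ≠ 0 := fun hv =>
        hu (bernoulliMass_eq_zero_of_klDiv_ne_top h b hv)
      have h1 : (bernoulliMeasure true false u).rnDeriv (bernoulliMeasure true false v) b *
          ENNReal.ofReal (bernoulliMass v b) = ENNReal.ofReal (bernoulliMass u b) := by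
        rw [← bernoulliMeasure_singleton, ← bernoulliMeasure_singleton, ← lintegral_singleton,
          ← withDensity_apply _ (measurableSet_singleton b), Measure.withDensity_rnDeriv_eq _ _ hac]
      have h2 := congrArg ENNReal.toReal h1
      rw [ENNReal.toReal_mul, ENNReal.toReal_ofReal (bernoulliMass_nonneg v b),
        ENNReal.toReal_ofReal (bernoulliMass_nonneg u b)] at h2
      rw [llr, likelihoodRatio, if_neg hu, eq_div_of_mul_eq hv h2, ← inv_div (bernoulliMass v b),
        Real.log_inv, mul_neg]
  rw [InformationTheory.toReal_klDiv_of_measure_eq hac (by simp), integral_bernoulliMeasure]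
  have h1 := key true
  have h2 := key false
  simp only [bernoulliMass, if_true, Bool.false_eq_true, if_false] at h1 h2
  simp only [smul_eq_mul, h1, h2, realKL]
  ring

/-! ### Termination and the consequences of soundness -/

lemma history_add_of_terminate {π : Policy k} {ω : SamplePath k} {t : ℕ} {a : Answer}
    (h : π (history π ω t) = .terminate a) : ∀ s, history π ω (t + s) = history π ω t
  | 0 => rfl
  | s + 1 => by
    have ih := history_add_of_terminate h s
    rw [← add_assoc, history]
    split
    · simp_all
    · exact ih

lemma terminate_mono {π : Policy k} {ω : SamplePath k} {a : Answer} {t n : ℕ} (htn : t ≤ n)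
    (h : π (history π ω t) = .terminate a) : π (history π ω n) = .terminate a := by
  obtain ⟨s, rfl⟩ := Nat.exists_eq_add_of_le htn
  rwa [history_add_of_terminate h]

lemma setOf_outputs_eq_iUnion (π : Policy k) (a : Answer) :
    {ω | Outputs π a ω} = ⋃ n, {ω | history π ω n ∈ {h | π h = .terminate a}} := by
  ext ω
  simp [Outputs]

lemma measurableSet_history_mem (π : Policy k) (n : ℕ) (A : Set (List (Fin k × Bool))) :
    MeasurableSet {ω : SamplePath k | history π ω n ∈ A} :=
  measurableSet_setOfPred.2 (measurable_comp_history π n (· ∈ A))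

lemma measurableSet_outputs (π : Policy k) (a : Answer) : MeasurableSet {ω | Outputs π a ω} := by
  rw [setOf_outputs_eq_iUnion]
  exact .iUnion fun n => measurableSet_history_mem π n _

lemma disjoint_outputs (π : Policy k) :
    Disjoint {ω | Outputs π .feasible ω} {ω | Outputs π .infeasible ω} := by
  rw [Set.disjoint_left]
  rintro ω ⟨t, ht⟩ ⟨s, hs⟩
  have h1 := terminate_mono (le_max_left t s) ht
  rw [terminate_mono (le_max_right t s) hs] at h1
  cases h1

lemma tendsto_measureReal_terminate (π : Policy k) (a : Answer) (μ : Measure (SamplePath k))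
    [IsFiniteMeasure μ] :
    Tendsto (fun n => μ.real {ω | history π ω n ∈ {h | π h = .terminate a}}) atTop
      (𝓝 (μ.real {ω | Outputs π a ω})) := by
  rw [setOf_outputs_eq_iUnion]
  exact (ENNReal.tendsto_toReal (measure_ne_top _ _)).comp
    (tendsto_measure_iUnion_atTop fun _ _ hmn _ => terminate_mono hmn)

lemma length_history_le_stoppingTime (π : Policy k) (ω : SamplePath k) (n : ℕ) :
    ((history π ω n).length : ℝ≥0∞) ≤ stoppingTime π ω := by
  refine le_iInf₂ fun t ⟨a, ha⟩ => Nat.cast_le.2 ?_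
  rcases le_total n t with h | h
  · exact (length_history_le π ω n).trans h
  · obtain ⟨s, rfl⟩ := Nat.exists_eq_add_of_le h
    rw [history_add_of_terminate ha]
    exact length_history_le π ω t

lemma measurable_stoppingTime (π : Policy k) : Measurable (stoppingTime π) := by
  classical
  refine .iInf fun t => ?_
  simp_rw [iInf_eq_if]
  exact .ite (measurableSet_history_mem π t {h | ∃ a, π h = .terminate a}) measurable_const
    measurable_const

lemma exists_outputs_of_stoppingTime_ne_top {π : Policy k} {ω : SamplePath k}
    (h : stoppingTime π ω ≠ ∞) : ∃ a, Outputs π a ω := by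
  by_contra! hn
  refine h ?_
  simp only [stoppingTime, iInf_eq_top]
  rintro t ⟨a, ha⟩
  exact absurd ⟨t, ha⟩ (hn a)

/-- A finite expectation forces almost sure termination, and the two outputs exclude each other. -/
lemma measureReal_outputs_add_eq_one {π : Policy k} {p : Fin k → I}
    (h : expectedStoppingTime π p ≠ ∞) :
    (law p).real {ω | Outputs π .feasible ω} + (law p).real {ω | Outputs π .infeasible ω} = 1 := by
  rw [← measureReal_union (disjoint_outputs π) (measurableSet_outputs π _), measureReal_def,
    (prob_compl_eq_zero_iff ((measurableSet_outputs π _).union (measurableSet_outputs π _))).1,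
    ENNReal.toReal_one]
  refine measure_mono_null (fun ω hω => ?_)
    (measure_eq_top_of_lintegral_ne_top (measurable_stoppingTime π).aemeasurable h)
  by_contra hne
  obtain ⟨a, ha⟩ := exists_outputs_of_stoppingTime_ne_top hne
  cases a
  exacts [hω (.inl ha), hω (.inr ha)]

lemma measureReal_outputs_add_le_one (π : Policy k) (p : Fin k → I) :
    (law p).real {ω | Outputs π .feasible ω} + (law p).real {ω | Outputs π .infeasible ω} ≤ 1 := by
  rw [← measureReal_union (disjoint_outputs π) (measurableSet_outputs π _)]
  exact measureReal_le_one

lemma IsSound.measureReal_infeasible_le {π : Policy k} {x ε δ : ℝ} (hπ : IsSound π x ε δ)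
    {p : Fin k → I} (hp : Feasible x ε p) : (law p).real {ω | Outputs π .infeasible ω} ≤ δ := by
  by_cases hb : p ∈ boundary k x ε
  · exact hπ.boundary_feasible p hb hp
  · linarith [hπ.feasible p hb hp, measureReal_outputs_add_le_one π p]

/-- On the boundary soundness bounds only the wrong output; almost sure termination gives the rest
of the mass to the right one. -/
lemma IsSound.le_measureReal_infeasible {π : Policy k} {x ε δ : ℝ} (hπ : IsSound π x ε δ)
    {p : Fin k → I} (hp : Infeasible x ε p) (hfin : expectedStoppingTime π p ≠ ∞) :
    1 - δ ≤ (law p).real {ω | Outputs π .infeasible ω} := by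
  by_cases hb : p ∈ boundary k x ε
  · linarith [hπ.boundary_infeasible p hb hp, measureReal_outputs_add_eq_one hfin]
  · exact hπ.infeasible p hb hp

/-! ### Expected counts of the actions -/

lemma sum_actionCount : ∀ h : List (Fin k × Bool), ∑ i, actionCount i h = h.length
  | [] => by simp [actionCount]
  | a :: h => by simp [actionCount_cons, Finset.sum_add_distrib, sum_actionCount h]

lemma actionCount_history_mono (π : Policy k) (i : Fin k) (ω : SamplePath k) :
    Monotone fun n => actionCount i (history π ω n) := by
  refine monotone_nat_of_le_succ fun n => ?_
  simp only [history]
  split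
  · rw [actionCount_cons]
    exact Nat.le_add_right _ _
  · rfl

/-- The expected number of times that the policy chooses action `i`. -/
noncomputable def expectedCount (π : Policy k) (p : Fin k → I) (i : Fin k) : ℝ≥0∞ :=
  ⨆ n, ∫⁻ ω, actionCount i (history π ω n) ∂law p

lemma sum_expectedCount_le (π : Policy k) (p : Fin k → I) :
    ∑ i, expectedCount π p i ≤ expectedStoppingTime π p := by
  simp only [expectedCount]
  rw [ENNReal.finsetSum_iSup_of_monotone fun i m n hmn =>
    lintegral_mono fun ω => Nat.cast_le.2 (actionCount_history_mono π i ω hmn)]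
  refine iSup_le fun n => ?_
  rw [← lintegral_finsetSum _ fun i _ =>
    measurable_comp_history π n fun h => (actionCount i h : ℝ≥0∞)]
  refine lintegral_mono fun ω => ?_
  rw [← Nat.cast_sum, sum_actionCount]
  exact length_history_le_stoppingTime π ω n

lemma integral_actionCount_le_toReal {π : Policy k} {p : Fin k → I} {i : Fin k}
    (h : expectedCount π p i ≠ ∞) (n : ℕ) :
    ∫ ω, (actionCount i (history π ω n) : ℝ) ∂law p ≤ (expectedCount π p i).toReal := by
  rw [integral_eq_lintegral_of_nonneg_ae (.of_forall fun ω => Nat.cast_nonneg _)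
    (measurable_comp_history π n fun h => (actionCount i h : ℝ)).aestronglyMeasurable]
  simp only [ENNReal.ofReal_natCast]
  exact ENNReal.toReal_mono h (le_iSup (fun n => ∫⁻ ω, actionCount i (history π ω n) ∂law p) n)

/-! ### Approaching an endpoint, and the bound for one action -/

lemma feasible_update {x ε : ℝ} (p : Fin k → I) (i : Fin k) {q : I} (hq : (q : ℝ) ∈ target x ε) :
    Feasible x ε (Function.update p i q) := by
  refine ⟨q, hq, Pi.single i 1, single_mem_stdSimplex ℝ i, ?_⟩
  simp [Pi.single_apply]

/-- An endpoint of the target set is a limit of means in the target set. -/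
lemma mem_closure_target {x ε : ℝ} (hx : x ∈ Set.Icc (0 : ℝ) 1) (b : I)
    (hb : |(b : ℝ) - x| = ε) : b ∈ closure {q : I | (q : ℝ) ∈ target x ε} := by
  rcases (abs_nonneg ((b : ℝ) - x)).eq_or_lt' with h0 | h0
  · refine subset_closure ?_
    rw [← hb, h0]
    simpa [target, sub_eq_zero] using h0
  · have hy : Tendsto (fun t : ℝ => (b : ℝ) + t * (x - b)) (𝓝[>] 0) (𝓝 b) :=
      (Continuous.tendsto' (by fun_prop) _ _ (by simp)).mono_left nhdsWithin_le_nhds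
    -- The projection only supplies a point of `I` for every `t`; for `t` in `(0, 1)` it does
    -- nothing, by convexity.
    have hy' : Tendsto (fun t : ℝ => Set.projIcc (0 : ℝ) 1 zero_le_one (b + t * (x - b)))
        (𝓝[>] 0) (𝓝 b) := by
      simpa [Function.comp_def] using (continuous_projIcc (h := zero_le_one' ℝ)).continuousAt.tendsto.comp hy
    refine mem_closure_of_tendsto hy' ?_
    filter_upwards [Ioo_mem_nhdsGT (zero_lt_one' ℝ)] with t ht
    have hmem : (b : ℝ) + t * (x - b) ∈ Set.Icc (0 : ℝ) 1 :=
      (convex_Icc (0 : ℝ) 1).add_smul_sub_mem b.2 hx ⟨ht.1.le, ht.2.le⟩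
    rw [Set.projIcc_of_mem _ hmem]
    have hne : ε ≠ 0 := by rw [← hb]; exact h0.ne'
    have : (b : ℝ) + t * (x - b) - x = (1 - t) * (b - x) := by ring
    simp only [target, Set.mem_ofPred_eq, if_neg hne, this, abs_mul, hb,
      abs_of_pos (sub_pos.2 ht.2)]
    have hεpos : 0 < ε := hb ▸ h0
    nlinarith [mul_pos ht.1 hεpos]

/-- Means near `v` keep the support of `v`. This lets the change of measure apply to all `q` near an
endpoint. -/
lemma eventually_bernoulliMass_ac {u v : I}
    (h : ∀ b, bernoulliMass v b = 0 → bernoulliMass u b = 0) :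
    ∀ᶠ q : I in 𝓝 v, ∀ b, bernoulliMass q b = 0 → bernoulliMass u b = 0 := by
  rw [eventually_all]
  intro b
  by_cases hv : bernoulliMass v b = 0
  · exact .of_forall fun _ _ => h b hv
  · have hc : Continuous fun q : I => bernoulliMass q b := by
      cases b <;> simp only [bernoulliMass] <;> split_ifs <;> fun_prop
    filter_upwards [hc.continuousAt.eventually_ne hv] with q hq h0
    exact absurd h0 hq

/-- The lower bound on the expected number of samples of one action, for one endpoint `b` of the
target set. -/
lemma log_le_realKL_mul_expectedCount {x ε δ : ℝ} (hx : x ∈ Set.Icc (0 : ℝ) 1) (hδ : 0 < δ)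
    (hδ' : δ < 1 / 2) {π : Policy k} (hπ : IsSound π x ε δ) {p : Fin k → I}
    (hp : Infeasible x ε p) (hfin : expectedStoppingTime π p ≠ ∞) (i : Fin k)
    (hi : expectedCount π p i ≠ ∞) (b : I) (hb : |(b : ℝ) - x| = ε)
    (hac : ∀ c, bernoulliMass b c = 0 → bernoulliMass (p i) c = 0) (hKL : 0 ≤ realKL (p i) b) :
    1 / 2 * Real.log (1 / (4 * δ)) ≤ realKL (p i) b * (expectedCount π p i).toReal := by
  let A : Set (List (Fin k × Bool)) := {h | π h = .terminate .infeasible}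
  have hlog : 0 ≤ Real.log (1 / δ) := Real.log_nonneg ((one_le_div hδ).2 (by linarith))
  have h1 : ∀ n, Real.log (1 / δ) * (law p).real {ω | history π ω n ∈ A} - Real.log 2 ≤
      realKL (p i) b * (expectedCount π p i).toReal := by
    intro n
    refine le_trans ?_ (mul_le_mul_of_nonneg_left (integral_actionCount_le_toReal hi n) hKL)
    have := mem_closure_iff_nhdsWithin_neBot.1 (mem_closure_target hx b hb)
    have hcont : Tendsto (fun q : I => realKL (p i) q)
        (𝓝[{q : I | (q : ℝ) ∈ target x ε}] b) (𝓝 (realKL (p i) b)) :=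
      ((continuousAt_realKL hac).comp continuous_subtype_val.continuousAt).tendsto.mono_left
        nhdsWithin_le_nhds
    refine ge_of_tendsto (hcont.mul_const _) ?_
    filter_upwards [self_mem_nhdsWithin,
      nhdsWithin_le_nhds (eventually_bernoulliMass_ac hac)] with q hq hq'
    refine log_mul_measureReal_sub_log_two_le π p i hq' n hδ (by linarith) A ?_
    refine le_trans (measureReal_mono ?_) (hπ.measureReal_infeasible_le (feasible_update p i hq))
    exact fun ω hω => ⟨n, hω⟩
  have h2 := le_of_tendsto' (((tendsto_measureReal_terminate π .infeasible (law p)).const_mul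
    (Real.log (1 / δ))).sub_const (Real.log 2)) h1
  have h3 := mul_le_mul_of_nonneg_left (hπ.le_measureReal_infeasible hp hfin) hlog
  have h4 : Real.log (1 / (4 * δ)) = Real.log (1 / δ) - 2 * Real.log 2 := by
    rw [show 1 / (4 * δ) = 1 / δ / 2 ^ 2 by field_simp; norm_num,
      Real.log_div (by positivity) (by norm_num), Real.log_pow]
    norm_num
  rw [h4]
  -- Here `1 - δ ≥ 1/2` is used; half of `2 * log 2` is the `log 2` lost in the change of measure.
  nlinarith

lemma inv_bernoulliKL_mul_le_expectedCount {x ε δ : ℝ} (hx : x ∈ Set.Icc (0 : ℝ) 1) (hδ : 0 < δ)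
    (hδ' : δ < 1 / 2) {π : Policy k} (hπ : IsSound π x ε δ) {p : Fin k → I}
    (hp : Infeasible x ε p) (hfin : expectedStoppingTime π p ≠ ∞) (i : Fin k) {y : ℝ}
    (hy : |y - x| = ε) :
    (bernoulliKL (p i) y)⁻¹ * ENNReal.ofReal (1 / 2 * Real.log (1 / (4 * δ))) ≤
      expectedCount π p i := by
  by_cases htop : bernoulliKL (p i) y = ∞
  · simp [htop]
  have hi : expectedCount π p i ≠ ∞ := ne_top_of_le_ne_top hfin <|
    (Finset.single_le_sum (f := expectedCount π p) (fun _ _ => zero_le) (Finset.mem_univ i)).trans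
      (sum_expectedCount_le π p)
  have hmem : y ∈ Set.Icc (0 : ℝ) 1 := by
    by_contra h
    exact htop (dif_neg h)
  have hdef : bernoulliKL (p i) y = InformationTheory.klDiv (bernoulliMeasure true false (p i))
      (bernoulliMeasure true false ⟨y, hmem⟩) := dif_pos hmem
  rw [hdef] at htop
  have hreal := realKL_eq_toReal_klDiv htop
  have h := log_le_realKL_mul_expectedCount hx hδ hδ' hπ hp hfin i hi ⟨y, hmem⟩ hy
    (bernoulliMass_eq_zero_of_klDiv_ne_top htop) (hreal ▸ ENNReal.toReal_nonneg)
  rw [hreal, ← hdef, ← ENNReal.toReal_mul] at h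
  rw [← hdef] at htop
  have h' := (ENNReal.ofReal_le_iff_le_toReal (ENNReal.mul_ne_top htop hi)).2 h
  -- The inverse is then `∞`, but `h'` makes the logarithmic factor `0`, and `∞ * 0 = 0`.
  by_cases h0 : bernoulliKL (p i) y = 0
  · rw [h0, zero_mul, nonpos_iff_eq_zero] at h'
    rw [h', mul_zero]
    exact zero_le
  · calc (bernoulliKL (p i) y)⁻¹ * ENNReal.ofReal (1 / 2 * Real.log (1 / (4 * δ)))
        ≤ (bernoulliKL (p i) y)⁻¹ * (bernoulliKL (p i) y * expectedCount π p i) := by gcongr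
      _ = expectedCount π p i := by
        rw [← mul_assoc, ENNReal.inv_mul_cancel h0 htop, one_mul]

end HullFeasibility

theorem mainTheorem1 {k : ℕ} (x ε δ : ℝ) (hx : x ∈ Set.Icc (0 : ℝ) 1) (hε : 0 ≤ ε)
    (hδ : 0 < δ) (hδ' : δ < 1 / 2)
    (π : HullFeasibility.Policy k) (hπ : HullFeasibility.IsSound π x ε δ)
    (p : Fin k → I) (hp : HullFeasibility.Infeasible x ε p) :
    (∑ i, max (HullFeasibility.bernoulliKL (p i) (x - ε))⁻¹
          (HullFeasibility.bernoulliKL (p i) (x + ε))⁻¹)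
        * ENNReal.ofReal (1 / 2 * Real.log (1 / (4 * δ)))
      ≤ HullFeasibility.expectedStoppingTime π p := by
  by_cases hfin : HullFeasibility.expectedStoppingTime π p = ∞
  · simp [hfin]
  refine le_trans ?_ (HullFeasibility.sum_expectedCount_le π p)
  rw [Finset.sum_mul]
  refine Finset.sum_le_sum fun i _ => ?_
  have h1 := HullFeasibility.inv_bernoulliKL_mul_le_expectedCount hx hδ hδ' hπ hp hfin i
    (y := x - ε) (by simpa using hε)
  have h2 := HullFeasibility.inv_bernoulliKL_mul_le_expectedCount hx hδ hδ' hπ hp hfin i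
    (y := x + ε) (by simpa using hε)
  rcases max_choice (HullFeasibility.bernoulliKL (p i) (x - ε))⁻¹
    (HullFeasibility.bernoulliKL (p i) (x + ε))⁻¹ with h | h <;> rw [h] <;> assumption
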